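/- Let $d, T, M$ be natural numbers, let $\boldsymbol\Sigma_0 \in \mathbb{R}^{d\times d}$ be symmetric positive definite, $\sigma > 0$, and $x_1,\dots,x_T \in \mathbb{R}^d$ fixed vectors. Let $$\boldsymbol\Sigma = \Big(\boldsymbol\Sigma_0^{-1} + \frac{1}{\sigma^2}\sum_{t=1}^T x_t x_t^\top\Big)^{-1}.$$ Let $\mathbf{Z}_0$ be a random $d\times M$ matrix and $\mathbf{z}_1,\dots,\mathbf{z}_T$ random vectors in $\mathbb{R}^M$ such that the $d$ rows of $\mathbf{Z}_0$ together with $\mathbf{z}_1,\dots,\mathbf{z}_T$ are $d+T$ mutually independent random vectors, each uniformly distributed on the unit sphere of $\mathbb{R}^M$. Define the $d \times M$ matrix $$\mathbf{A} = \boldsymbol\Sigma\Big(\boldsymbol\Sigma_0^{-1/2}\mathbf{Z}_0 + \frac1\sigma\sum_{t=1}^T x_t\mathbf{z}_t^\top\Big),$$ where $\boldsymbol\Sigma_0^{-1/2}$ is the symmetric positive definite square root of $\boldsymbol\Sigma_0^{-1}$. Let $\varepsilon,\delta\in(0,1)$. (a) If $M \ge 64\,\varepsilon^{-2}\big(d\log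 9 + \log(2/\delta)\big)$, then with probability at least $1-\delta$, $$(1-\varepsilon)\,x^\top\boldsymbol\Sigma x \le x^\top \mathbf{A}\mathbf{A}^\top x \le (1+\varepsilon)\,x^\top\boldsymbol\Sigma x$$ simultaneously for all $x\in\mathbb{R}^d$ with $\|x\|=1$. (b) If $\mathcal{X}\subset\mathbb{R}^d$ is a finite set and $M \ge 64\,\varepsilon^{-2}\log(2|\mathcal{X}|/\delta)$, then with probability at least $1-\delta$ the same two inequalities hold simultaneously for all $x\in\mathcal{X}$. -/

import Mathlib

open MeasureTheory ProbabilityTheory Matrix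
open scoped MatrixOrder

noncomputable section

namespace Hypermodel

/-- The uniform distribution on the unit sphere of `ℝ^m`, as a measure on `ℝ^m`: the surface
measure of the sphere, normalized to total mass one. -/
def uniformSphere (m : ℕ) : Measure (EuclideanSpace ℝ (Fin m)) :=
  (ProbabilityTheory.cond (volume : Measure (EuclideanSpace ℝ (Fin m))).toSphere Set.univ).map
    (Subtype.val : Metric.sphere (0 : EuclideanSpace ℝ (Fin m)) 1 → EuclideanSpace ℝ (Fin m))

/-- The random vectors `z i` are independent and each is uniformly distributed on the unit sphere
of `ℝ^m`. -/
structure IsSpherical {Ω ι : Type*} [MeasurableSpace Ω] {m : ℕ} (P : Measure Ω)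
    (z : ι → Ω → EuclideanSpace ℝ (Fin m)) : Prop where
  hasLaw : ∀ i, HasLaw (z i) (uniformSphere m) P
  indep : iIndepFun z P

/-- The posterior covariance matrix `Σ = (Σ₀⁻¹ + σ⁻² ∑ₜ xₜ xₜᵀ)⁻¹`. -/
def posteriorCov {d T : ℕ} (S₀ : Matrix (Fin d) (Fin d) ℝ) (σ : ℝ)
    (x : Fin T → EuclideanSpace ℝ (Fin d)) : Matrix (Fin d) (Fin d) ℝ :=
  (S₀⁻¹ + (1 / σ ^ 2) • ∑ t, vecMulVec (x t).ofLp (x t).ofLp)⁻¹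

/-- The factor `A = Σ (Σ₀^{-1/2} Z₀ + σ⁻¹ ∑ₜ xₜ zₜᵀ)`, a `d × M` matrix. The rows of `Z₀` are given
as a family of vectors of `ℝ^M`, and `Σ₀^{-1/2}` is the power of the continuous functional
calculus, that is, the inverse of the positive square root of a positive definite `Σ₀`. -/
def factor {d T M : ℕ} (S₀ : Matrix (Fin d) (Fin d) ℝ) (σ : ℝ)
    (x : Fin T → EuclideanSpace ℝ (Fin d))
    (Z₀ : Fin d → EuclideanSpace ℝ (Fin M)) (z : Fin T → EuclideanSpace ℝ (Fin M)) :
    Matrix (Fin d) (Fin M) ℝ :=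
  posteriorCov S₀ σ x *
    (S₀ ^ (-(1 / 2) : ℝ) * Matrix.of (fun i j => Z₀ i j)
      + (1 / σ) • ∑ t, vecMulVec (x t).ofLp (z t).ofLp)

/-- The quadratic form `uᵀ B u`. -/
def quadForm {d : ℕ} (B : Matrix (Fin d) (Fin d) ℝ) (u : EuclideanSpace ℝ (Fin d)) : ℝ :=
  u.ofLp ⬝ᵥ (B *ᵥ u.ofLp)

/-- `(1 - ε) uᵀ S u ≤ uᵀ A Aᵀ u ≤ (1 + ε) uᵀ S u` for all `u ∈ 𝒳`. -/
def IsApproxFactorOn {d M : ℕ} (ε : ℝ) (S : Matrix (Fin d) (Fin d) ℝ)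
    (A : Matrix (Fin d) (Fin M) ℝ) (𝒳 : Set (EuclideanSpace ℝ (Fin d))) : Prop :=
  ∀ u ∈ 𝒳, (1 - ε) * quadForm S u ≤ quadForm (A * Aᵀ) u ∧
    quadForm (A * Aᵀ) u ≤ (1 + ε) * quadForm S u

end Hypermodel

end

/-! Let `ζ i` be the `d + T` spherical vectors. Since `Σ` and `Σ₀^{-1/2}` are symmetric, `uᵀ A = ∑
i, a i • ζ i` with deterministic coefficients `a`, linear in `u`, and `‖a‖ ^ 2 = uᵀ Σ u`. Both parts
thus say that `‖∑ i, a i • ζ i‖ ^ 2` lies within a factor `1 ± ε` of `‖a‖ ^ 2`.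

For one fixed `a` this is a Chernoff bound. A uniform unit vector is sub-Gaussian: a standard
Gaussian is a radius times an independent uniform direction, and Jensen's inequality replaces the
radius by its mean, of order `√M`. Integrating out one `ζ i` at a time then bounds the exponential
moments of the squared norm (`IsSpherical.lintegral_exp_norm_sum_sq_le`), and relative error `t` is
exceeded with probability at most `2 exp (-M t² / 16)`.

Part (b) is a union bound. Part (a) applies it with `t = ε / 2` to a `1/4`-net of at most `9 ^ d`
points in the space of coefficient vectors; passing from the net to all vectors doubles the error
(`abs_norm_map_sq_sub_le_of_net`). -/

/-! ### Polar coordinates, the chi distribution and Gaussian comparison -/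

section Sphere

variable {E : Type*} [NormedAddCommGroup E] [InnerProductSpace ℝ E] [FiniteDimensional ℝ E]
  [MeasurableSpace E] [BorelSpace E]

/-- Integration in polar coordinates. -/
theorem lintegral_eq_lintegral_toSphere [Nontrivial E] (μ : Measure E) [μ.IsAddHaarMeasure]
    {f : E → ENNReal} (hf : Measurable f) :
    ∫⁻ x, f x ∂μ = ∫⁻ z : Metric.sphere (0 : E) 1,
      (∫⁻ r in Set.Ioi (0 : ℝ), ENNReal.ofReal (r ^ (Module.finrank ℝ E - 1)) *
        f (r • (z : E))) ∂μ.toSphere := by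
  have h1 : ∫⁻ x, f x ∂μ = ∫⁻ x : ({(0)}ᶜ : Set E), f x.1 ∂(μ.comap (↑)) := by
    rw [lintegral_subtype_comap (measurableSet_singleton _).compl f,
      restrict_compl_singleton]
  rw [h1]
  have h2 := μ.measurePreserving_homeomorphUnitSphereProd.lintegral_comp_emb
    (Homeomorph.measurableEmbedding _)
    (fun p : Metric.sphere (0 : E) 1 × Set.Ioi (0 : ℝ) => f ((p.2 : ℝ) • (p.1 : E)))
  have h3 : ∀ x : ({(0)}ᶜ : Set E), f x.1 =
      f (((homeomorphUnitSphereProd E x).2 : ℝ) • ((homeomorphUnitSphereProd E x).1 : E)) := by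
    intro x
    congr 1
    have hx : ‖(x : E)‖ ≠ 0 := norm_ne_zero_iff.2 x.2
    simp [smul_smul, hx]
  simp_rw [h3]
  rw [h2, lintegral_prod _ (by fun_prop)]
  refine lintegral_congr fun z => ?_
  rw [Measure.volumeIoiPow, lintegral_withDensity_eq_lintegral_mul _ (by fun_prop) (by fun_prop),
    ← lintegral_subtype_comap measurableSet_Ioi]
  rfl

theorem integrableOn_pow_mul_exp_linear_sub_sq (n : ℕ) (s : ℝ) :
    IntegrableOn (fun r : ℝ => r ^ n * Real.exp (r * s - r ^ 2 / 2)) (Set.Ioi 0) := by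
  -- Domination by `r s - r² / 2 ≤ s² - r² / 4`.
  have h := (integrable_rpow_mul_exp_neg_mul_sq (b := 1 / 4) (by norm_num)
    (s := (n : ℝ)) (by linarith [Nat.cast_nonneg (α := ℝ) n])).const_mul (Real.exp (s ^ 2))
  refine Integrable.mono' h.integrableOn (by fun_prop) ?_
  refine (ae_restrict_iff' measurableSet_Ioi).2 (.of_forall fun r hr => ?_)
  have hr : 0 < r := hr
  rw [Real.norm_of_nonneg (by positivity), Real.rpow_natCast, mul_left_comm, ← Real.exp_add]
  gcongr
  nlinarith [sq_nonneg (r - 2 * s)]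

theorem integral_pow_mul_exp_neg_sq_half (n : ℕ) :
    ∫ r in Set.Ioi (0 : ℝ), r ^ n * Real.exp (-(r ^ 2 / 2)) =
      (1 / 2 : ℝ) ^ (-((n : ℝ) + 1) / 2) * (1 / 2) * Real.Gamma (((n : ℝ) + 1) / 2) := by
  have h := integral_rpow_mul_exp_neg_mul_rpow (p := 2) (q := n) (b := 1 / 2) (by norm_num)
    (by linarith [Nat.cast_nonneg (α := ℝ) n]) (by norm_num)
  rw [← h]
  refine setIntegral_congr_fun measurableSet_Ioi fun r _ => ?_
  simp only [Real.rpow_natCast, Real.rpow_ofNat]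
  ring_nf

/-- The mean of the chi distribution with `n` degrees of freedom. -/
noncomputable def chiMean (n : ℕ) : ℝ :=
  (∫ r in Set.Ioi (0 : ℝ), r ^ n * Real.exp (-(r ^ 2 / 2))) /
    ∫ r in Set.Ioi (0 : ℝ), r ^ (n - 1) * Real.exp (-(r ^ 2 / 2))

theorem integral_pow_mul_exp_neg_sq_half_pos (n : ℕ) :
    0 < ∫ r in Set.Ioi (0 : ℝ), r ^ n * Real.exp (-(r ^ 2 / 2)) := by
  rw [integral_pow_mul_exp_neg_sq_half]
  have := Real.Gamma_pos_of_pos (s := ((n : ℝ) + 1) / 2) (by positivity)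
  positivity

/-- Log-convexity of Gamma gives `Γ(n/2 + 1)² ≤ Γ((n+1)/2) Γ((n+3)/2)`. As `chiMean n = √2
Γ((n+1)/2) / Γ(n/2)`, its square is at least `n² / (n + 1)`, hence at least `n / 2`. -/
theorem half_le_chiMean_sq {n : ℕ} (hn : 0 < n) : (n : ℝ) / 2 ≤ chiMean n ^ 2 := by
  have hn1 : (1 : ℝ) ≤ n := by exact_mod_cast hn
  have hc : ((n - 1 : ℕ) : ℝ) = n - 1 := by rw [Nat.cast_sub hn]; simp
  rw [chiMean, integral_pow_mul_exp_neg_sq_half, integral_pow_mul_exp_neg_sq_half, hc]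
  have hg : 0 < Real.Gamma ((n : ℝ) / 2) := Real.Gamma_pos_of_pos (by positivity)
  have hg1 : 0 < Real.Gamma (((n : ℝ) + 1) / 2) := Real.Gamma_pos_of_pos (by positivity)
  have h1 := Real.Gamma_mul_add_mul_le_rpow_Gamma_mul_rpow_Gamma
    (s := ((n : ℝ) + 1) / 2) (t := ((n : ℝ) + 1) / 2 + 1) (a := 1 / 2) (b := 1 / 2)
    (by positivity) (by positivity) (by norm_num) (by norm_num) (by norm_num)
  rw [Real.Gamma_add_one (by positivity), ← Real.mul_rpow (by positivity) (by positivity),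
    ← Real.sqrt_eq_rpow,
    show (1 / 2 : ℝ) * (((n : ℝ) + 1) / 2) + 1 / 2 * (((n : ℝ) + 1) / 2 + 1) = n / 2 + 1 by ring,
    Real.Gamma_add_one (by positivity)] at h1
  have h2 := pow_le_pow_left₀ (by positivity) h1 2
  rw [Real.sq_sqrt (by positivity)] at h2
  have e1 : (1 / 2 : ℝ) ^ (-((n : ℝ) + 1) / 2) =
      (1 / 2 : ℝ) ^ (-((n : ℝ) - 1 + 1) / 2) * Real.sqrt 2 := by
    rw [Real.sqrt_eq_rpow, show (2 : ℝ) ^ (1 / 2 : ℝ) = (1 / 2 : ℝ) ^ (-(1 / 2) : ℝ) by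
      rw [Real.rpow_neg (by norm_num), ← Real.inv_rpow (by norm_num)]; norm_num,
      ← Real.rpow_add (by norm_num)]
    ring_nf
  have hp : 0 < (1 / 2 : ℝ) ^ (-((n : ℝ) - 1 + 1) / 2) := by positivity
  rw [e1, show ((n : ℝ) - 1 + 1) / 2 = n / 2 by ring]
  set p := (1 / 2 : ℝ) ^ (-((n : ℝ) - 1 + 1) / 2)
  set G := Real.Gamma ((n : ℝ) / 2)
  set G1 := Real.Gamma (((n : ℝ) + 1) / 2)
  have e2 : (p * √2 * (1 / 2) * G1 / (p * (1 / 2) * G)) ^ 2 = 2 * G1 ^ 2 / G ^ 2 := by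
    have : (√2 : ℝ) ^ 2 = 2 := Real.sq_sqrt (by norm_num)
    field_simp
    rw [this]
  rw [e2, le_div_iff₀ (by positivity)]
  have h3 : (n : ℝ) / 2 * G ^ 2 * ((n + 1) / 2) ≤ 2 * G1 ^ 2 * ((n + 1) / 2) := by
    have : (n : ℝ) / 2 * G ^ 2 * ((n + 1) / 2) ≤ 2 * (n / 2 * G) ^ 2 := by
      have : 0 ≤ n * (n - 1) * G ^ 2 := by
        have : (0 : ℝ) ≤ n - 1 := by linarith
        positivity
      nlinarith
    nlinarith
  exact le_of_mul_le_mul_right h3 (by positivity)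

/-- Jensen's inequality for the chi distribution. -/
theorem exp_chiMean_mul_le {n : ℕ} (hn : 0 < n) (s : ℝ) :
    Real.exp (chiMean n * s) * ∫ r in Set.Ioi (0 : ℝ), r ^ (n - 1) * Real.exp (-(r ^ 2 / 2)) ≤
      ∫ r in Set.Ioi (0 : ℝ), r ^ (n - 1) * Real.exp (r * s - r ^ 2 / 2) := by
  have hi : ∀ k : ℕ, IntegrableOn (fun r : ℝ => r ^ k * Real.exp (-(r ^ 2 / 2))) (Set.Ioi 0) :=
    fun k => by simpa using integrableOn_pow_mul_exp_linear_sub_sq k 0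
  have hm : chiMean n * ∫ r in Set.Ioi (0 : ℝ), r ^ (n - 1) * Real.exp (-(r ^ 2 / 2)) =
      ∫ r in Set.Ioi (0 : ℝ), r ^ n * Real.exp (-(r ^ 2 / 2)) :=
    div_mul_cancel₀ _ (integral_pow_mul_exp_neg_sq_half_pos _).ne'
  set m := chiMean n
  -- Integrate the tangent line of `exp` at `m * s`; its linear term vanishes because `m` is the
  -- mean.
  have e : Real.exp (m * s) * ∫ r in Set.Ioi (0 : ℝ), r ^ (n - 1) * Real.exp (-(r ^ 2 / 2)) =
      ∫ r in Set.Ioi (0 : ℝ), (Real.exp (m * s) * (1 - m * s) *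
          (r ^ (n - 1) * Real.exp (-(r ^ 2 / 2))) +
        Real.exp (m * s) * s * (r ^ n * Real.exp (-(r ^ 2 / 2)))) := by
    rw [integral_add ((hi _).const_mul _) ((hi _).const_mul _), integral_const_mul,
      integral_const_mul, ← hm]
    ring
  rw [e]
  refine setIntegral_mono_on (((hi _).const_mul _).add ((hi _).const_mul _))
    (integrableOn_pow_mul_exp_linear_sub_sq _ _) measurableSet_Ioi fun r hr => ?_
  have hr : 0 < r := hr
  have h1 : Real.exp (r * s - r ^ 2 / 2) =
      Real.exp (m * s) * Real.exp ((r - m) * s) * Real.exp (-(r ^ 2 / 2)) := by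
    rw [← Real.exp_add, ← Real.exp_add]; ring_nf
  have h2 : r ^ n = r ^ (n - 1) * r := by rw [← pow_succ, Nat.sub_add_cancel hn]
  have h3 := Real.add_one_le_exp ((r - m) * s)
  rw [h1, h2]
  have h4 : 0 ≤ r ^ (n - 1) * Real.exp (m * s) * Real.exp (-(r ^ 2 / 2)) := by positivity
  nlinarith [mul_le_mul_of_nonneg_left h3 h4]

theorem lintegral_exp_inner_sub_norm_sq (v : E) :
    ∫⁻ x : E, ENNReal.ofReal (Real.exp (inner ℝ v x - ‖x‖ ^ 2 / 2)) =
      ENNReal.ofReal ((2 * Real.pi) ^ (Module.finrank ℝ E / 2 : ℝ) * Real.exp (‖v‖ ^ 2 / 2)) := by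
  have hb : 0 < ((1 / 2 : ℝ) : ℂ).re := by norm_num
  have hf : ∀ x : E, Complex.exp (-((1 / 2 : ℝ) : ℂ) * ‖x‖ ^ 2 + ((1 : ℝ) : ℂ) * inner ℝ v x) =
      ((Real.exp (inner ℝ v x - ‖x‖ ^ 2 / 2) : ℝ) : ℂ) := by
    intro x
    push_cast
    ring_nf
  have h1 := GaussianFourier.integrable_cexp_neg_mul_sq_norm_add hb ((1 : ℝ) : ℂ) v
  have h2 := GaussianFourier.integral_cexp_neg_mul_sq_norm_add hb ((1 : ℝ) : ℂ) v
  simp_rw [hf] at h1 h2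
  rw [integral_complex_ofReal] at h2
  have h3 : Integrable fun x : E => Real.exp (inner ℝ v x - ‖x‖ ^ 2 / 2) := by
    have := h1.re
    simpa only [RCLike.re_to_complex, Complex.ofReal_re] using this
  rw [← ofReal_integral_eq_lintegral_ofReal h3 (.of_forall fun _ => (Real.exp_pos _).le)]
  congr 1
  apply Complex.ofReal_injective
  rw [h2]
  push_cast
  rw [Complex.ofReal_cpow (by positivity)]
  push_cast
  congr 2 <;> ring_nf

/-- In polar coordinates the Gaussian exponential moment averages `exp (r ⟪v, z⟫)` over radius and
direction. Jensen in `r` bounds it below by the value at the mean radius. -/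
theorem lintegral_exp_inner_toSphere_le [Nontrivial E] (v : E) :
    ∫⁻ z : Metric.sphere (0 : E) 1,
        ENNReal.ofReal (Real.exp (chiMean (Module.finrank ℝ E) * inner ℝ v (z : E)))
        ∂(volume : Measure E).toSphere ≤
      (volume : Measure E).toSphere Set.univ * ENNReal.ofReal (Real.exp (‖v‖ ^ 2 / 2)) := by
  set n := Module.finrank ℝ E with hn
  have hn0 : 0 < n := Module.finrank_pos
  have polar : ∀ v : E, ∫⁻ x : E, ENNReal.ofReal (Real.exp (inner ℝ v x - ‖x‖ ^ 2 / 2)) =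
      ∫⁻ z : Metric.sphere (0 : E) 1, ENNReal.ofReal (∫ r in Set.Ioi (0 : ℝ),
        r ^ (n - 1) * Real.exp (r * inner ℝ v (z : E) - r ^ 2 / 2))
        ∂(volume : Measure E).toSphere := by
    intro v
    rw [lintegral_eq_lintegral_toSphere _ (by fun_prop)]
    refine lintegral_congr fun z => ?_
    rw [ofReal_integral_eq_lintegral_ofReal (integrableOn_pow_mul_exp_linear_sub_sq _ _)]
    · refine setLIntegral_congr_fun measurableSet_Ioi fun r hr => ?_
      have hr : 0 < r := hr
      have hz : ‖(z : E)‖ = 1 := by simp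
      rw [← ENNReal.ofReal_mul (by positivity), inner_smul_right, norm_smul, hz,
        Real.norm_of_nonneg hr.le, mul_one]
    · refine (ae_restrict_iff' measurableSet_Ioi).2 (.of_forall fun r hr => ?_)
      have hr : 0 < r := hr
      simp only [Pi.zero_apply]
      positivity
  set I := ∫ r in Set.Ioi (0 : ℝ), r ^ (n - 1) * Real.exp (-(r ^ 2 / 2))
  have hI : 0 < I := integral_pow_mul_exp_neg_sq_half_pos _
  -- The case `v = 0` identifies the Gaussian normalizing constant with `I` times the surface area,
  -- so neither needs evaluating.
  have h0 := polar 0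
  rw [lintegral_exp_inner_sub_norm_sq] at h0
  simp only [inner_zero_left, mul_zero, zero_sub, norm_zero, lintegral_const] at h0
  have hv := polar v
  rw [lintegral_exp_inner_sub_norm_sq] at hv
  have hC : ENNReal.ofReal ((2 * Real.pi) ^ (n / 2 : ℝ)) =
      ENNReal.ofReal I * (volume : Measure E).toSphere Set.univ := by
    simpa using h0
  rw [ENNReal.ofReal_mul (by positivity), hC] at hv
  have h1 : ENNReal.ofReal I * ∫⁻ z : Metric.sphere (0 : E) 1,
        ENNReal.ofReal (Real.exp (chiMean n * inner ℝ v (z : E)))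
        ∂(volume : Measure E).toSphere ≤
      ENNReal.ofReal I * ((volume : Measure E).toSphere Set.univ *
        ENNReal.ofReal (Real.exp (‖v‖ ^ 2 / 2))) := by
    rw [← mul_assoc, hv, ← lintegral_const_mul _ (by fun_prop)]
    refine lintegral_mono fun z => ?_
    rw [← ENNReal.ofReal_mul hI.le, mul_comm]
    exact ENNReal.ofReal_le_ofReal (exp_chiMean_mul_le hn0 _)
  exact (ENNReal.mul_le_mul_iff_right (by simpa using hI) ENNReal.ofReal_ne_top).1 h1

end Sphere

/-! ### The uniform distribution on the sphere -/

namespace Hypermodel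

theorem uniformSphere_isProbabilityMeasure {m : ℕ} (hm : 0 < m) :
    IsProbabilityMeasure (uniformSphere m) := by
  have : Nonempty (Fin m) := ⟨⟨0, hm⟩⟩
  have := cond_isProbabilityMeasure (μ := (volume : Measure (EuclideanSpace ℝ (Fin m))).toSphere)
    (s := Set.univ) (Measure.measure_univ_ne_zero.2 (Measure.toSphere_ne_zero _))
  exact Measure.isProbabilityMeasure_map (by fun_prop)

theorem ae_norm_eq_one_uniformSphere (m : ℕ) : ∀ᵐ z ∂uniformSphere m, ‖z‖ = 1 := by
  rw [uniformSphere, ae_map_iff (by fun_prop) (measurableSet_eq_fun (by fun_prop) (by fun_prop))]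
  exact .of_forall fun z => by simp

/-- The uniform distribution on the sphere is sub-Gaussian. -/
theorem lintegral_exp_inner_uniformSphere_le {m : ℕ} (hm : 0 < m)
    (v : EuclideanSpace ℝ (Fin m)) :
    ∫⁻ z, ENNReal.ofReal (Real.exp (inner ℝ v z)) ∂uniformSphere m ≤
      ENNReal.ofReal (Real.exp (‖v‖ ^ 2 / m)) := by
  have : Nonempty (Fin m) := ⟨⟨0, hm⟩⟩
  have hm' : (0 : ℝ) < m := by exact_mod_cast hm
  have hc := half_le_chiMean_sq hm
  have hc0 : chiMean m ≠ 0 := by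
    intro h
    rw [h] at hc
    linarith [sq (0 : ℝ)]
  -- Rescaling cancels the mean radius; the exponent becomes `‖v‖² / (2 chiMean²) ≤ ‖v‖² / m`.
  have h := lintegral_exp_inner_toSphere_le ((chiMean m)⁻¹ • v)
  simp only [finrank_euclideanSpace, Fintype.card_fin, inner_smul_left, map_inv₀, conj_trivial,
    mul_inv_cancel_left₀ hc0] at h
  rw [uniformSphere, lintegral_map (by fun_prop) (by fun_prop), ProbabilityTheory.cond,
    Measure.restrict_univ, lintegral_smul_measure, smul_eq_mul]
  refine (mul_le_mul_right h _).trans ?_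
  rw [← mul_assoc, ENNReal.inv_mul_cancel
    (Measure.measure_univ_ne_zero.2 (Measure.toSphere_ne_zero _)) (measure_ne_top _ _), one_mul]
  refine ENNReal.ofReal_le_ofReal (Real.exp_le_exp.2 ?_)
  rw [norm_smul, mul_pow, norm_inv, inv_pow, Real.norm_eq_abs, sq_abs,
    div_eq_mul_inv _ (m : ℝ), mul_comm _ (‖v‖ ^ 2), mul_div_assoc]
  gcongr
  rw [div_eq_mul_inv, ← mul_inv]
  exact inv_anti₀ hm' (by linarith)

end Hypermodel

/-! ### Concentration of weighted sums of spherical vectors -/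

namespace Hypermodel

/-- One step of a random walk with spherical increments. -/
theorem lintegral_exp_norm_add_smul_sq_le {m : ℕ} (hm : 0 < m) (μ a : ℝ)
    (s : EuclideanSpace ℝ (Fin m)) :
    ∫⁻ z, ENNReal.ofReal (Real.exp (m / 2 * (μ * ‖s + a • z‖ ^ 2))) ∂uniformSphere m ≤
      ENNReal.ofReal (Real.exp (m / 2 * (μ * a ^ 2))) *
        ENNReal.ofReal (Real.exp (m / 2 * ((μ + 2 * μ ^ 2 * a ^ 2) * ‖s‖ ^ 2))) := by
  have hm' : (0 : ℝ) < m := by exact_mod_cast hm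
  -- As `‖z‖ = 1`, only the cross term of the squared norm is random, and it is linear in `z`.
  have h1 : ∫⁻ z, ENNReal.ofReal (Real.exp (m / 2 * (μ * ‖s + a • z‖ ^ 2))) ∂uniformSphere m =
      ∫⁻ z, ENNReal.ofReal (Real.exp (m / 2 * (μ * (‖s‖ ^ 2 + a ^ 2)))) *
        ENNReal.ofReal (Real.exp (inner ℝ ((m * μ * a) • s) z)) ∂uniformSphere m := by
    refine lintegral_congr_ae ?_
    filter_upwards [ae_norm_eq_one_uniformSphere m] with z hz
    rw [← ENNReal.ofReal_mul (Real.exp_pos _).le, ← Real.exp_add, norm_add_sq_real,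
      inner_smul_left, inner_smul_right, norm_smul, hz]
    simp only [Real.norm_eq_abs, mul_one, sq_abs, conj_trivial]
    ring_nf
  rw [h1, lintegral_const_mul _ (by fun_prop)]
  refine (mul_le_mul_right (lintegral_exp_inner_uniformSphere_le hm _) _).trans_eq ?_
  rw [← ENNReal.ofReal_mul (Real.exp_pos _).le, ← Real.exp_add,
    ← ENNReal.ofReal_mul (Real.exp_pos _).le, ← Real.exp_add, norm_smul, mul_pow,
    Real.norm_eq_abs, sq_abs]
  congr 2
  field_simp
  ring

variable {Ω ι : Type*} [MeasurableSpace Ω] {P : Measure Ω} {m : ℕ}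
  {z : ι → Ω → EuclideanSpace ℝ (Fin m)}

/-- Induction with `μ` free: integrating out a vector of squared weight `b` turns `μ` into `μ + 2 μ²
b`, and the quadratic term absorbs this drift. Both signs of `μ` are needed, one for each tail. -/
theorem IsSpherical.lintegral_exp_norm_sum_sq_le [IsProbabilityMeasure P]
    (hz : IsSpherical P z) (hm : 0 < m) (a : ι → ℝ) (F : Finset ι) (μ : ℝ)
    (hμ : |μ| * ∑ i ∈ F, a i ^ 2 ≤ 1 / 4) :
    ∫⁻ ω, ENNReal.ofReal (Real.exp (m / 2 * (μ * ‖∑ i ∈ F, a i • z i ω‖ ^ 2))) ∂P ≤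
      ENNReal.ofReal (Real.exp (m / 2 *
        (μ * ∑ i ∈ F, a i ^ 2 + 2 * μ ^ 2 * (∑ i ∈ F, a i ^ 2) ^ 2))) := by
  classical
  have hm' : (0 : ℝ) < m := by exact_mod_cast hm
  induction F using Finset.induction_on generalizing μ with
  | empty => simp
  | insert k F hk ih =>
    have hprob := uniformSphere_isProbabilityMeasure hm
    rw [Finset.sum_insert hk] at hμ ⊢
    set s := ∑ i ∈ F, a i ^ 2
    have hs : 0 ≤ s := Finset.sum_nonneg fun i _ => sq_nonneg _
    have hb : 0 ≤ a k ^ 2 := sq_nonneg _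
    have hzm : ∀ i, AEMeasurable (z i) P := fun i => (hz.hasLaw i).aemeasurable
    have hind : IndepFun (fun ω => ∑ i ∈ F, a i • z i ω) (z k) P := by
      -- Weight `1` at `k` makes one rescaled family supply both the weighted sum over `F` and `z k`
      -- itself.
      let φ : ι → EuclideanSpace ℝ (Fin m) → EuclideanSpace ℝ (Fin m) :=
        fun i v => (if i = k then 1 else a i) • v
      have h := (hz.indep.comp φ fun i => by fun_prop).indepFun_finsetSum_of_notMem₀
        (fun i => ((by fun_prop : Measurable (φ i)).comp_aemeasurable (hzm i))) hk
      convert h using 1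
      · ext1 ω
        rw [Finset.sum_apply]
        refine Finset.sum_congr rfl fun i hi => ?_
        have : i ≠ k := fun h => hk (h ▸ hi)
        simp [φ, this]
      · ext1 ω
        simp [φ]
    have hS : AEMeasurable (fun ω => ∑ i ∈ F, a i • z i ω) P :=
      Finset.aemeasurable_fun_sum _ fun i _ => (hzm i).const_smul (a i)
    have hmap := (indepFun_iff_map_prod_eq_prod_map_map hS (hzm k)).1 hind
    rw [(hz.hasLaw k).map_eq] at hmap
    have hp1 := Measure.isProbabilityMeasure_map hS
    calc ∫⁻ ω, ENNReal.ofReal (Real.exp (m / 2 * (μ * ‖∑ i ∈ insert k F, a i • z i ω‖ ^ 2))) ∂P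
        = ∫⁻ p, ENNReal.ofReal (Real.exp (m / 2 * (μ * ‖p.1 + a k • p.2‖ ^ 2)))
            ∂(P.map fun ω => (∑ i ∈ F, a i • z i ω, z k ω)) := by
          rw [lintegral_map' (by fun_prop) (hS.prodMk (hzm k))]
          simp_rw [Finset.sum_insert hk, add_comm]
      _ ≤ ∫⁻ v, ENNReal.ofReal (Real.exp (m / 2 * (μ * a k ^ 2))) *
            ENNReal.ofReal (Real.exp (m / 2 * ((μ + 2 * μ ^ 2 * a k ^ 2) * ‖v‖ ^ 2)))
            ∂(P.map fun ω => ∑ i ∈ F, a i • z i ω) := by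
          rw [hmap, lintegral_prod _ (by fun_prop)]
          exact lintegral_mono fun v => lintegral_exp_norm_add_smul_sq_le hm _ _ _
      _ = ENNReal.ofReal (Real.exp (m / 2 * (μ * a k ^ 2))) * ∫⁻ ω, ENNReal.ofReal (Real.exp
            (m / 2 * ((μ + 2 * μ ^ 2 * a k ^ 2) * ‖∑ i ∈ F, a i • z i ω‖ ^ 2))) ∂P := by
          rw [lintegral_const_mul _ (by fun_prop), lintegral_map' (by fun_prop) hS]
      _ ≤ _ := by
          generalize a k ^ 2 = b at *
          have e1 : |μ| * s ≤ 1 / 4 := by nlinarith [abs_nonneg μ]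
          have e2 : |μ| * b ≤ 1 / 4 := by nlinarith [abs_nonneg μ]
          have e3 : |μ + 2 * μ ^ 2 * b| ≤ |μ| + 2 * |μ| ^ 2 * b := by
            refine (abs_add_le _ _).trans_eq ?_
            rw [abs_mul, abs_of_nonneg hb, abs_mul, abs_pow]; simp
          -- The smallness condition survives: the drift adds at most `|μ| b / 2`, less than the
          -- `|μ| b` set free.
          have e4 : |μ + 2 * μ ^ 2 * b| * s ≤ 1 / 4 := by
            calc |μ + 2 * μ ^ 2 * b| * s ≤ (|μ| + 2 * |μ| ^ 2 * b) * s := by gcongr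
              _ = |μ| * s + 2 * (|μ| * b) * (|μ| * s) := by ring
              _ ≤ |μ| * s + 2 * (|μ| * b) * (1 / 4) := by
                have : 0 ≤ |μ| * b := by positivity
                gcongr
              _ ≤ 1 / 4 := by
                have : 0 ≤ |μ| * b := by positivity
                linarith
          refine (mul_le_mul_right (ih _ e4) _).trans ?_
          rw [← ENNReal.ofReal_mul (Real.exp_pos _).le, ← Real.exp_add, ← mul_add]
          refine ENNReal.ofReal_le_ofReal (Real.exp_le_exp.2 ?_)
          refine mul_le_mul_of_nonneg_left ?_ (by positivity)
          have e5 : μ * s ≤ 1 / 4 := (mul_le_mul_of_nonneg_right (le_abs_self μ) hs).trans e1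
          have e6 : 4 * (μ * s) * (s * b) ≤ s * b := by nlinarith [mul_nonneg hs hb]
          have e7 : 4 * (μ * s) ^ 2 * b ^ 2 ≤ b ^ 2 := by
            have : (μ * s) ^ 2 ≤ (1 / 4) ^ 2 := by
              rw [← sq_abs, abs_mul, abs_of_nonneg hs]
              gcongr
            nlinarith [sq_nonneg b]
          -- Twice this quantity is exactly the gap between the two exponents.
          have e8 : 0 ≤ μ ^ 2 * (s * b + b ^ 2 - 4 * (μ * s) * (s * b) - 4 * (μ * s) ^ 2 * b ^ 2) :=
            mul_nonneg (sq_nonneg _) (by linarith)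
          nlinarith

/-- Concentration of a linear combination of independent uniform vectors on the sphere. -/
theorem IsSpherical.measure_abs_norm_sum_sq_sub_le [IsProbabilityMeasure P] [Fintype ι]
    (hz : IsSpherical P z) (hm : 0 < m) (a : ι → ℝ) {t : ℝ} (ht : 0 < t) (ht1 : t ≤ 1) :
    P {ω | ¬ |‖∑ i, a i • z i ω‖ ^ 2 - ∑ i, a i ^ 2| ≤ t * ∑ i, a i ^ 2} ≤
      ENNReal.ofReal (2 * Real.exp (-(m * t ^ 2 / 16))) := by
  have hm' : (0 : ℝ) < m := by exact_mod_cast hm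
  have hs : 0 ≤ ∑ i, a i ^ 2 := Finset.sum_nonneg fun i _ => sq_nonneg _
  rcases hs.eq_or_lt with h0 | hs
  · have ha : ∀ i, a i = 0 := fun i => by
      have := (Finset.sum_eq_zero_iff_of_nonneg fun i _ => sq_nonneg (a i)).1 h0.symm i
        (Finset.mem_univ i)
      exact pow_eq_zero_iff two_ne_zero |>.1 this
    simp [ha]
  -- With `s = ∑ i, a i ^ 2`, the choice `|μ| s = t / 4` minimizes the Chernoff exponent `2 (μ s)² -
  -- t |μ| s`; the sign of `μ` selects the tail.
  have key : ∀ μ : ℝ, |μ| = t / (4 * ∑ i, a i ^ 2) →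
      P {ω | μ * ∑ i, a i ^ 2 + t ^ 2 / 4 ≤ μ * ‖∑ i, a i • z i ω‖ ^ 2} ≤
        ENNReal.ofReal (Real.exp (-(m * t ^ 2 / 16))) := by
    intro μ hμ
    set s := ∑ i, a i ^ 2
    have h1 := hz.lintegral_exp_norm_sum_sq_le hm a Finset.univ μ (by
      rw [hμ, div_mul_eq_mul_div, div_le_iff₀ (by positivity)]; nlinarith)
    have hmeas : AEMeasurable (fun ω =>
        ENNReal.ofReal (Real.exp (m / 2 * (μ * ‖∑ i, a i • z i ω‖ ^ 2)))) P := by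
      have hS : AEMeasurable (fun ω => ∑ i, a i • z i ω) P :=
        Finset.aemeasurable_fun_sum _ fun i _ => (hz.hasLaw i).aemeasurable.const_smul (a i)
      fun_prop
    have h2 := mul_meas_ge_le_lintegral₀ hmeas
      (ENNReal.ofReal (Real.exp (m / 2 * (μ * s + t ^ 2 / 4))))
    have hμs : μ ^ 2 * s ^ 2 = t ^ 2 / 16 := by
      rw [← sq_abs μ, hμ]; field_simp; norm_num
    have h3 : ENNReal.ofReal (Real.exp (m / 2 * (μ * s + t ^ 2 / 4))) *
          P {ω | μ * s + t ^ 2 / 4 ≤ μ * ‖∑ i, a i • z i ω‖ ^ 2} ≤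
        ENNReal.ofReal (Real.exp (m / 2 * (μ * s + t ^ 2 / 4))) *
          ENNReal.ofReal (Real.exp (-(m * t ^ 2 / 16))) := by
      rw [← ENNReal.ofReal_mul (Real.exp_pos _).le, ← Real.exp_add]
      refine le_trans (le_of_eq_of_le ?_ (h2.trans h1)) (le_of_eq ?_)
      · congr 2
        ext ω
        simp only [Set.mem_ofPred_eq]
        rw [ENNReal.ofReal_le_ofReal_iff (Real.exp_pos _).le, Real.exp_le_exp,
          mul_le_mul_iff_right₀ (by positivity)]
      · congr 2
        linear_combination (m : ℝ) * hμs
    exact (ENNReal.mul_le_mul_iff_right (by simpa using Real.exp_pos _)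
      ENNReal.ofReal_ne_top).1 h3
  set s := ∑ i, a i ^ 2
  have hpos : 0 < t / (4 * s) := by positivity
  have hts : t / (4 * s) * (t * s) = t ^ 2 / 4 := by field_simp
  have hsub : {ω | ¬ |‖∑ i, a i • z i ω‖ ^ 2 - s| ≤ t * s} ⊆
      {ω | t / (4 * s) * s + t ^ 2 / 4 ≤ t / (4 * s) * ‖∑ i, a i • z i ω‖ ^ 2} ∪
      {ω | -(t / (4 * s)) * s + t ^ 2 / 4 ≤ -(t / (4 * s)) * ‖∑ i, a i • z i ω‖ ^ 2} := by
    intro ω hω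
    simp only [Set.mem_ofPred_eq, not_le, lt_abs] at hω
    rcases hω with h | h
    · left
      simp only [Set.mem_ofPred_eq]
      nlinarith
    · right
      simp only [Set.mem_ofPred_eq]
      nlinarith
  refine (measure_mono hsub).trans ((measure_union_le _ _).trans ?_)
  rw [two_mul, ENNReal.ofReal_add (Real.exp_pos _).le (Real.exp_pos _).le]
  exact add_le_add (key _ (abs_of_pos hpos)) (key _ (by rw [abs_neg, abs_of_pos hpos]))

end Hypermodel

/-! ### Nets on the sphere and near-isometries -/

section Net

/-- A `1/4`-separated set in the closed unit ball has at most `9 ^ dim` elements. -/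
theorem card_le_nine_pow_of_separated {E : Type*} [NormedAddCommGroup E] [NormedSpace ℝ E]
    [FiniteDimensional ℝ E] (s : Finset E) (hs : ∀ c ∈ s, ‖c‖ ≤ 1)
    (h : ∀ c ∈ s, ∀ d ∈ s, c ≠ d → 1 / 4 ≤ ‖c - d‖) :
    s.card ≤ 9 ^ Module.finrank ℝ E := by
  borelize E
  let μ : Measure E := Measure.addHaar
  -- Balls of half the separation are disjoint and lie in the ball of radius `1 + 1/8`; the ratio of
  -- radii is `9`.
  have hδ : (0 : ℝ) < 1 / 8 := by norm_num
  have hρ : (0 : ℝ) < 9 / 8 := by norm_num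
  have D : Set.Pairwise (s : Set E) (Function.onFun Disjoint fun c => Metric.ball c (1 / 8)) := by
    rintro c hc d hd hcd
    apply Metric.ball_disjoint_ball
    rw [dist_eq_norm]
    linarith [h c hc d hd hcd]
  have hsub : ⋃ c ∈ s, Metric.ball c (1 / 8 : ℝ) ⊆ Metric.ball (0 : E) (9 / 8) := by
    refine Set.iUnion₂_subset fun x hx => Metric.ball_subset_ball' ?_
    rw [dist_zero_right]
    linarith [hs x hx]
  have I : (s.card : ENNReal) * ENNReal.ofReal ((1 / 8) ^ Module.finrank ℝ E) *
      μ (Metric.ball 0 1) ≤ ENNReal.ofReal ((9 / 8) ^ Module.finrank ℝ E) * μ (Metric.ball 0 1) := by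
    rw [← μ.addHaar_ball_of_pos 0 hρ]
    refine le_of_eq_of_le ?_ (measure_mono hsub)
    rw [measure_biUnion_finset D fun c _ => measurableSet_ball]
    simp only [μ.addHaar_ball_of_pos _ hδ, Finset.sum_const, nsmul_eq_mul, mul_assoc]
  have J := (ENNReal.mul_le_mul_iff_left (Metric.measure_ball_pos _ _ zero_lt_one).ne'
    measure_ball_lt_top.ne).1 I
  have K : (s.card : ℝ) ≤ (9 : ℝ) ^ Module.finrank ℝ E := by
    have := ENNReal.toReal_le_of_le_ofReal (by positivity) J
    rw [ENNReal.toReal_mul, ENNReal.toReal_natCast, ENNReal.toReal_ofReal (by positivity),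
      div_pow, div_pow, one_pow, mul_one_div] at this
    exact (div_le_div_iff_of_pos_right (by positivity)).1 this
  exact_mod_cast K

/-- A `1/4`-separated subset of the sphere of largest cardinality is a net, since an uncovered point
could be added. -/
theorem exists_quarter_net_sphere (E : Type*) [NormedAddCommGroup E] [NormedSpace ℝ E]
    [FiniteDimensional ℝ E] :
    ∃ N : Finset E, (∀ y ∈ N, ‖y‖ = 1) ∧ N.card ≤ 9 ^ Module.finrank ℝ E ∧
      ∀ w : E, ‖w‖ = 1 → ∃ y ∈ N, ‖w - y‖ ≤ 1 / 4 := by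
  classical
  let Q : ℕ → Prop := fun k => ∃ N : Finset E, N.card = k ∧ (∀ y ∈ N, ‖y‖ = 1) ∧
    ∀ c ∈ N, ∀ d ∈ N, c ≠ d → 1 / 4 ≤ ‖c - d‖
  have hQ : ∀ k, Q k → k ≤ 9 ^ Module.finrank ℝ E := by
    rintro k ⟨N, rfl, h1, h2⟩
    exact card_le_nine_pow_of_separated N (fun c hc => (h1 c hc).le) h2
  have h0 : Q 0 := ⟨∅, by simp⟩
  obtain ⟨N, hc, h1, h2⟩ := Nat.findGreatest_spec (P := Q) (Nat.zero_le _) h0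
  refine ⟨N, h1, hc ▸ Nat.findGreatest_le _, fun w hw => ?_⟩
  by_contra! hcon
  have hwN : w ∉ N := fun hw' => by
    have := hcon w hw'
    norm_num at this
  have hQ' : Q (N.card + 1) := by
    refine ⟨insert w N, Finset.card_insert_of_notMem hwN, ?_, ?_⟩
    · simpa [hw] using h1
    · intro c hc d hd hcd
      rcases Finset.mem_insert.1 hc with rfl | hc' <;>
        rcases Finset.mem_insert.1 hd with rfl | hd'
      · exact absurd rfl hcd
      · exact (hcon d hd').le
      · rw [norm_sub_rev]; exact (hcon c hc').le
      · exact h2 c hc' d hd' hcd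
  have := Nat.le_findGreatest (hQ _ hQ') hQ'
  omega

/-- The weight `c` serves to balance a short `a - b` against a long `a + b`. -/
theorem norm_sq_polarization {G : Type*} [NormedAddCommGroup G] [InnerProductSpace ℝ G] {c : ℝ}
    (hc : c ≠ 0) (a b : G) :
    ‖c • (a - b) + c⁻¹ • (a + b)‖ ^ 2 - ‖c • (a - b) - c⁻¹ • (a + b)‖ ^ 2 =
      4 * (‖a‖ ^ 2 - ‖b‖ ^ 2) := by
  have h : inner ℝ (a - b) (a + b) = ‖a‖ ^ 2 - ‖b‖ ^ 2 := by
    rw [inner_sub_left, inner_add_right, inner_add_right, real_inner_self_eq_norm_sq,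
      real_inner_self_eq_norm_sq, real_inner_comm]
    ring
  rw [norm_add_sq_real, norm_sub_sq_real, inner_smul_left, inner_smul_right, h]
  simp only [conj_trivial]
  field_simp
  ring

/-- A linear map that is nearly isometric on a `1/4`-net is nearly isometric. -/
theorem abs_norm_map_sq_sub_le_of_net {V F : Type*} [NormedAddCommGroup V] [InnerProductSpace ℝ V]
    [FiniteDimensional ℝ V] [NormedAddCommGroup F] [InnerProductSpace ℝ F] (f : V →ₗ[ℝ] F)
    {N : Finset V} (hN : ∀ y ∈ N, ‖y‖ = 1) (hnet : ∀ w : V, ‖w‖ = 1 → ∃ y ∈ N, ‖w - y‖ ≤ 1 / 4)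
    {ε : ℝ} (hf : ∀ y ∈ N, |‖f y‖ ^ 2 - ‖y‖ ^ 2| ≤ ε / 2 * ‖y‖ ^ 2) (v : V) :
    |‖f v‖ ^ 2 - ‖v‖ ^ 2| ≤ ε * ‖v‖ ^ 2 := by
  rcases eq_or_ne v 0 with rfl | hv
  · simp
  set q : V → ℝ := fun v => ‖f v‖ ^ 2 - ‖v‖ ^ 2 with hq
  have hsmul : ∀ (c : ℝ) (v : V), q (c • v) = c ^ 2 * q v := by
    intro c v
    simp only [hq, map_smul, norm_smul, mul_pow, Real.norm_eq_abs, sq_abs]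
    ring
  have hcont : Continuous fun v => |q v| := by
    have : Continuous f := f.continuous_of_finiteDimensional
    fun_prop
  have hunit : ∀ v : V, v ≠ 0 → ‖(‖v‖⁻¹ • v)‖ = 1 := fun v hv => by
    rw [norm_smul, norm_inv, norm_norm, inv_mul_cancel₀ (norm_ne_zero_iff.2 hv)]
  have := FiniteDimensional.proper_real V
  obtain ⟨w, hw, hmax⟩ := (isCompact_sphere (0 : V) 1).exists_isMaxOn
    ⟨‖v‖⁻¹ • v, by simpa using hunit v hv⟩ hcont.continuousOn
  have hw : ‖w‖ = 1 := by simpa using hw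
  have hK : ∀ v : V, |q v| ≤ |q w| * ‖v‖ ^ 2 := by
    intro v
    rcases eq_or_ne v 0 with rfl | hv
    · simp [hq]
    have h1 : |q (‖v‖⁻¹ • v)| ≤ |q w| := hmax (by simpa using hunit v hv)
    have h2 : q v = ‖v‖ ^ 2 * q (‖v‖⁻¹ • v) := by
      rw [← hsmul, smul_smul, mul_inv_cancel₀ (norm_ne_zero_iff.2 hv), one_smul]
    rw [h2, abs_mul, abs_of_nonneg (by positivity), mul_comm]
    gcongr
  obtain ⟨y, hyN, hy⟩ := hnet w hw
  have hy1 := hN y hyN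
  -- With `c² = 8` both weighted vectors have squared norm at most `1/2`. The parallelogram law then
  -- gives `|q w - q y| ≤ |q w| / 2`, which the maximality of `w` lets the left side absorb.
  set c := √(8 : ℝ)
  have hc : c ^ 2 = 8 := Real.sq_sqrt (by norm_num)
  have hc0 : c ≠ 0 := by positivity
  have hpol : q w - q y =
      (q (c • (w - y) + c⁻¹ • (w + y)) - q (c • (w - y) - c⁻¹ • (w + y))) / 4 := by
    simp only [hq, map_add, map_sub, map_smul]
    linarith [norm_sq_polarization hc0 w y, norm_sq_polarization hc0 (f w) (f y)]
  have hpar := parallelogram_law_with_norm ℝ (c • (w - y)) (c⁻¹ • (w + y))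
  have hn1 : ‖c • (w - y)‖ ^ 2 = 8 * ‖w - y‖ ^ 2 := by
    rw [norm_smul, mul_pow, Real.norm_eq_abs, sq_abs, hc]
  have hn2 : ‖c⁻¹ • (w + y)‖ ^ 2 = 8⁻¹ * ‖w + y‖ ^ 2 := by
    rw [norm_smul, mul_pow, Real.norm_eq_abs, sq_abs, inv_pow, hc]
  have hn3 : ‖w + y‖ ^ 2 ≤ 4 := by
    have := norm_add_le w y
    rw [hw, hy1] at this
    nlinarith [norm_nonneg (w + y)]
  have hn4 : ‖w - y‖ ^ 2 ≤ 1 / 16 := by nlinarith [norm_nonneg (w - y)]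
  have hdiff : |q w - q y| ≤ |q w| / 2 := by
    rw [hpol, abs_div, abs_of_pos (by norm_num : (0 : ℝ) < 4)]
    have h1 := abs_sub (q (c • (w - y) + c⁻¹ • (w + y))) (q (c • (w - y) - c⁻¹ • (w + y)))
    have h2 := hK (c • (w - y) + c⁻¹ • (w + y))
    have h3 := hK (c • (w - y) - c⁻¹ • (w + y))
    have h4 : ‖c • (w - y) + c⁻¹ • (w + y)‖ ^ 2 + ‖c • (w - y) - c⁻¹ • (w + y)‖ ^ 2 ≤ 2 := by
      nlinarith
    have h5 := mul_le_mul_of_nonneg_left h4 (abs_nonneg (q w))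
    linarith
  have hqy : |q y| ≤ ε / 2 := by simpa [hq, hy1] using hf y hyN
  have hqw : |q w| ≤ ε := by
    have := abs_sub_abs_le_abs_sub (q w) (q y)
    linarith
  exact (hK v).trans (by gcongr)

end Net

/-! ### The factor as a linear combination of the random vectors -/

namespace Hypermodel

theorem rpow_neg_half_mul_self {d : ℕ} {S₀ : Matrix (Fin d) (Fin d) ℝ} (hS₀ : S₀.PosDef) :
    S₀ ^ (-(1 / 2) : ℝ) * S₀ ^ (-(1 / 2) : ℝ) = S₀⁻¹ := by
  have h0 : 0 ≤ S₀ := hS₀.posSemidef.nonneg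
  rw [← CFC.rpow_add hS₀.isUnit, show (-(1 / 2) + -(1 / 2) : ℝ) = -1 by norm_num]
  have h := CFC.rpow_neg_one_eq_inv hS₀.isUnit.unit h0
  rw [IsUnit.unit_spec] at h
  rw [h, Matrix.coe_units_inv, IsUnit.unit_spec]

theorem transpose_rpow {d : ℕ} (S₀ : Matrix (Fin d) (Fin d) ℝ) (r : ℝ) :
    (S₀ ^ r)ᵀ = S₀ ^ r := by
  have h : 0 ≤ S₀ ^ r := CFC.rpow_nonneg
  simpa [Matrix.IsHermitian, conjTranspose_eq_transpose_of_trivial] using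
    (Matrix.nonneg_iff_posSemidef.1 h).isHermitian

section Factor

variable {d T : ℕ} {S₀ : Matrix (Fin d) (Fin d) ℝ} (σ : ℝ) (x : Fin T → EuclideanSpace ℝ (Fin d))

theorem posDef_posteriorPrecision (hS₀ : S₀.PosDef) :
    (S₀⁻¹ + (1 / σ ^ 2) • ∑ t, vecMulVec (x t).ofLp (x t).ofLp).PosDef := by
  refine hS₀.inv.add_posSemidef (PosSemidef.smul (posSemidef_sum _ fun t _ => ?_) (by positivity))
  simpa using posSemidef_vecMulVec_self_star (x t).ofLp

theorem transpose_posteriorCov (hS₀ : S₀.PosDef) :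
    (posteriorCov S₀ σ x)ᵀ = posteriorCov S₀ σ x := by
  have h := (posDef_posteriorPrecision σ x hS₀).inv.isHermitian
  rwa [Matrix.IsHermitian, conjTranspose_eq_transpose_of_trivial] at h

variable (S₀) in
/-- The coefficients of `uᵀ A` with respect to the random vectors that `A` is built from. -/
noncomputable def factorCoeff :
    EuclideanSpace ℝ (Fin d) →ₗ[ℝ] EuclideanSpace ℝ (Fin d ⊕ Fin T) where
  toFun u := WithLp.toLp 2 (Sum.elim
    (S₀ ^ (-(1 / 2) : ℝ) *ᵥ (posteriorCov S₀ σ x *ᵥ u.ofLp))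
    (fun t => 1 / σ * ((posteriorCov S₀ σ x *ᵥ u.ofLp) ⬝ᵥ (x t).ofLp)))
  map_add' u v := by
    ext i
    rcases i with i | t <;> simp [mulVec_add, add_dotProduct, mul_add]
  map_smul' c u := by
    ext i
    rcases i with i | t <;> simp [mulVec_smul, smul_dotProduct, mul_left_comm]

/-- With `w = Σ u`, the squared norm is `wᵀ Σ₀⁻¹ w + σ⁻² ∑ (w ⬝ xₜ)² = wᵀ Σ⁻¹ w = uᵀ Σ u`. -/
theorem norm_factorCoeff_sq (hS₀ : S₀.PosDef) (u : EuclideanSpace ℝ (Fin d)) :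
    ‖factorCoeff S₀ σ x u‖ ^ 2 = quadForm (posteriorCov S₀ σ x) u := by
  set w := posteriorCov S₀ σ x *ᵥ u.ofLp with hw
  set R := S₀ ^ (-(1 / 2) : ℝ) with hR
  have hu : (S₀⁻¹ + (1 / σ ^ 2) • ∑ t, vecMulVec (x t).ofLp (x t).ofLp) *ᵥ w = u.ofLp := by
    rw [hw, posteriorCov, mulVec_mulVec, mul_nonsing_inv _
      ((Matrix.isUnit_iff_isUnit_det _).1 (posDef_posteriorPrecision σ x hS₀).isUnit), one_mulVec]
  have h1 : (R *ᵥ w) ⬝ᵥ (R *ᵥ w) = (S₀⁻¹ *ᵥ w) ⬝ᵥ w := by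
    rw [← rpow_neg_half_mul_self hS₀, dotProduct_mulVec, ← mulVec_transpose, transpose_rpow,
      mulVec_mulVec]
  have h2 : ‖factorCoeff S₀ σ x u‖ ^ 2 =
      (R *ᵥ w) ⬝ᵥ (R *ᵥ w) + ∑ t, (1 / σ * (w ⬝ᵥ (x t).ofLp)) ^ 2 := by
    rw [EuclideanSpace.real_norm_sq_eq, Fintype.sum_sum_type]
    simp only [factorCoeff, LinearMap.coe_mk, AddHom.coe_mk, Sum.elim_inl, Sum.elim_inr]
    congr 1
    exact Finset.sum_congr rfl fun i _ => sq _
  rw [h2, h1, quadForm, ← hw, ← hu, add_mulVec, add_dotProduct, smul_mulVec, smul_dotProduct,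
    sum_mulVec, sum_dotProduct, smul_eq_mul, Finset.mul_sum]
  congr 1
  refine Finset.sum_congr rfl fun t _ => ?_
  rw [vecMulVec_mulVec, op_smul_eq_smul, smul_dotProduct, dotProduct_comm w]
  simp only [smul_eq_mul]
  ring

theorem quadForm_factor_mul_transpose {M : ℕ} (hS₀ : S₀.PosDef)
    (Z₀ : Fin d → EuclideanSpace ℝ (Fin M)) (z : Fin T → EuclideanSpace ℝ (Fin M))
    (u : EuclideanSpace ℝ (Fin d)) :
    quadForm (factor S₀ σ x Z₀ z * (factor S₀ σ x Z₀ z)ᵀ) u =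
      ‖∑ i, factorCoeff S₀ σ x u i • Sum.elim Z₀ z i‖ ^ 2 := by
  have h : u.ofLp ᵥ* factor S₀ σ x Z₀ z =
      (∑ i, factorCoeff S₀ σ x u i • Sum.elim Z₀ z i : EuclideanSpace ℝ (Fin M)).ofLp := by
    rw [factor, ← vecMul_vecMul, ← mulVec_transpose (posteriorCov S₀ σ x), transpose_posteriorCov σ x hS₀, vecMul_add,
      ← vecMul_vecMul, ← mulVec_transpose (S₀ ^ (-(1 / 2) : ℝ)), transpose_rpow]
    ext j
    simp [factorCoeff, vecMul_smul, vecMul_sum, vecMul_vecMulVec, Finset.mul_sum, vecMul,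
      dotProduct, mul_assoc, Finset.sum_mul]
  rw [quadForm, ← mulVec_mulVec, dotProduct_mulVec, mulVec_transpose, h,
    EuclideanSpace.real_norm_sq_eq]
  exact Finset.sum_congr rfl fun i _ => (sq _).symm

theorem isApproxFactorOn_of_abs_le {M : ℕ} (hS₀ : S₀.PosDef) {ε : ℝ}
    {Z₀ : Fin d → EuclideanSpace ℝ (Fin M)} {z : Fin T → EuclideanSpace ℝ (Fin M)}
    {𝒳 : Set (EuclideanSpace ℝ (Fin d))}
    (h : ∀ u ∈ 𝒳, |‖∑ i, factorCoeff S₀ σ x u i • Sum.elim Z₀ z i‖ ^ 2 -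
      ‖factorCoeff S₀ σ x u‖ ^ 2| ≤ ε * ‖factorCoeff S₀ σ x u‖ ^ 2) :
    IsApproxFactorOn ε (posteriorCov S₀ σ x) (factor S₀ σ x Z₀ z) 𝒳 := by
  intro u hu
  have := abs_le.1 (h u hu)
  rw [quadForm_factor_mul_transpose σ x hS₀, ← norm_factorCoeff_sq σ x hS₀]
  constructor <;> linarith

end Factor

/-! ### Union bound -/

section UnionBound

variable {Ω ι : Type*} [MeasurableSpace Ω] {P : Measure Ω} [IsProbabilityMeasure P] {m : ℕ}
  {z : ι → Ω → EuclideanSpace ℝ (Fin m)} [Fintype ι]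

/-- Only monotonicity and subadditivity enter, so neither set has to be measurable. -/
theorem ofReal_one_sub_le_measure {s t : Set Ω} {δ : ℝ} (ht : P t ≤ ENNReal.ofReal δ)
    (hst : ∀ ω, ω ∉ t → ω ∈ s) (hδ : 0 ≤ δ) : ENNReal.ofReal (1 - δ) ≤ P s := by
  rw [ENNReal.ofReal_sub _ hδ, ENNReal.ofReal_one, tsub_le_iff_right, ← measure_univ (μ := P)]
  refine (measure_mono fun ω _ => ?_).trans ((measure_union_le s t).trans (by gcongr))
  by_cases h : ω ∈ t
  · exact Or.inr h
  · exact Or.inl (hst ω h)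

theorem IsSpherical.measure_exists_lt_abs_le (hz : IsSpherical P z) (hm : 0 < m) {α : Type*}
    (X : Finset α) (a : α → EuclideanSpace ℝ ι) {t : ℝ} (ht : 0 < t) (ht1 : t ≤ 1) :
    P {ω | ∃ u ∈ X, ¬ |‖∑ i, a u i • z i ω‖ ^ 2 - ‖a u‖ ^ 2| ≤ t * ‖a u‖ ^ 2} ≤
      ENNReal.ofReal (X.card * (2 * Real.exp (-(m * t ^ 2 / 16)))) := by
  have hset : {ω | ∃ u ∈ X, ¬ |‖∑ i, a u i • z i ω‖ ^ 2 - ‖a u‖ ^ 2| ≤ t * ‖a u‖ ^ 2} =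
      ⋃ u ∈ X, {ω | ¬ |‖∑ i, a u i • z i ω‖ ^ 2 - ∑ i, a u i ^ 2| ≤ t * ∑ i, a u i ^ 2} := by
    ext ω
    simp only [EuclideanSpace.real_norm_sq_eq (a _), Set.mem_ofPred_eq, Set.mem_iUnion, exists_prop]
  rw [hset]
  refine (measure_biUnion_finset_le _ _).trans ?_
  refine (Finset.sum_le_sum fun u _ =>
    hz.measure_abs_norm_sum_sq_sub_le hm (fun i => a u i) ht ht1).trans_eq ?_
  rw [Finset.sum_const, nsmul_eq_mul, ENNReal.ofReal_mul (Nat.cast_nonneg _),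
    ENNReal.ofReal_natCast]

theorem mul_two_mul_exp_neg_le {c δ y : ℝ} (hc : 0 < c) (hδ : 0 < δ)
    (h : Real.log (2 * c / δ) ≤ y) : c * (2 * Real.exp (-y)) ≤ δ := by
  rw [Real.log_le_iff_le_exp (by positivity), div_le_iff₀ hδ] at h
  rw [Real.exp_neg, ← mul_assoc, ← div_eq_mul_inv, div_le_iff₀ (Real.exp_pos _)]
  linarith

end UnionBound

end Hypermodel

/-! ### The main theorem -/

theorem mainTheorem6 {Ω : Type*} [MeasurableSpace Ω] (P : Measure Ω) [IsProbabilityMeasure P]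
    (d T M : ℕ) (S₀ : Matrix (Fin d) (Fin d) ℝ) (hS₀ : S₀.PosDef) (σ : ℝ) (hσ : 0 < σ)
    (x : Fin T → EuclideanSpace ℝ (Fin d))
    (Z₀ : Fin d → Ω → EuclideanSpace ℝ (Fin M)) (z : Fin T → Ω → EuclideanSpace ℝ (Fin M))
    (hz : Hypermodel.IsSpherical P (Sum.elim Z₀ z))
    (ε δ : ℝ) (hε : 0 < ε) (hε1 : ε < 1) (hδ : 0 < δ) (hδ1 : δ < 1) :
    (64 * (ε ^ 2)⁻¹ * (d * Real.log 9 + Real.log (2 / δ)) ≤ M →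
      ENNReal.ofReal (1 - δ) ≤
        P {ω | Hypermodel.IsApproxFactorOn ε (Hypermodel.posteriorCov S₀ σ x)
          (Hypermodel.factor S₀ σ x (fun i => Z₀ i ω) (fun t => z t ω))
          (Metric.sphere (0 : EuclideanSpace ℝ (Fin d)) 1)}) ∧
    (∀ 𝒳 : Finset (EuclideanSpace ℝ (Fin d)),
      64 * (ε ^ 2)⁻¹ * Real.log (2 * 𝒳.card / δ) ≤ M →
      ENNReal.ofReal (1 - δ) ≤
        P {ω | Hypermodel.IsApproxFactorOn ε (Hypermodel.posteriorCov S₀ σ x)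
          (Hypermodel.factor S₀ σ x (fun i => Z₀ i ω) (fun t => z t ω))
          (𝒳 : Set (EuclideanSpace ℝ (Fin d)))}) := by
  have helim : ∀ i ω, Sum.elim Z₀ z i ω =
      Sum.elim (fun i => Z₀ i ω) (fun t => z t ω) i := by
    rintro (i | t) ω <;> rfl
  -- The constant `64` is `16 * 2²`: the Chernoff denominator, and error `ε / 2` on the net.
  have hM : ∀ L : ℝ, 64 * (ε ^ 2)⁻¹ * L ≤ M → L ≤ M * (ε / 2) ^ 2 / 16 := by
    intro L hL
    have : 64 * (ε ^ 2)⁻¹ * L * (ε ^ 2 / 64) ≤ M * (ε ^ 2 / 64) := by gcongr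
    have e : 64 * (ε ^ 2)⁻¹ * L * (ε ^ 2 / 64) = L := by field_simp
    linarith
  have hM0 : ∀ L : ℝ, 0 < L → L ≤ M * (ε / 2) ^ 2 / 16 → 0 < M := by
    intro L hL h
    rcases Nat.eq_zero_or_pos M with rfl | h0
    · simp at h; linarith
    · exact h0
  have h2δ : 1 < 2 / δ := by rw [lt_div_iff₀ hδ]; linarith
  constructor
  · intro h
    have h := hM _ h
    have hMpos : 0 < M := hM0 _ (by
      have := Real.log_pos h2δ
      have := Real.log_pos (show (1 : ℝ) < 9 by norm_num)
      positivity) h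
    -- The net lives among the coefficient vectors, where the error is relative to the Euclidean
    -- norm; this range has dimension at most `d`, whatever `T` is.
    set V := LinearMap.range (Hypermodel.factorCoeff S₀ σ x)
    obtain ⟨N, hN1, hNcard, hnet⟩ := exists_quarter_net_sphere V
    have hV : Module.finrank ℝ V ≤ d := by
      simpa using LinearMap.finrank_range_le (Hypermodel.factorCoeff S₀ σ x)
    have hcard : (N.card : ℝ) ≤ 9 ^ d := by
      exact_mod_cast hNcard.trans (Nat.pow_le_pow_right (by norm_num) hV)
    refine Hypermodel.ofReal_one_sub_le_measure
      ((hz.measure_exists_lt_abs_le hMpos N (fun v : V => (v : EuclideanSpace ℝ (Fin d ⊕ Fin T)))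
        (half_pos hε) (by linarith)).trans (ENNReal.ofReal_le_ofReal ?_)) (fun ω hω => ?_) hδ.le
    · refine le_trans (by gcongr) (Hypermodel.mul_two_mul_exp_neg_le (c := 9 ^ d)
        (by positivity) hδ (le_of_eq_of_le ?_ h))
      rw [mul_comm (2 : ℝ), mul_div_assoc, Real.log_mul (by positivity) (by positivity),
        Real.log_pow]
    · refine Hypermodel.isApproxFactorOn_of_abs_le σ x hS₀ fun u _ => ?_
      simp only [Set.mem_ofPred_eq, not_exists, not_and, not_not, helim] at hω
      let f : V →ₗ[ℝ] EuclideanSpace ℝ (Fin M) :=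
        { toFun v := ∑ i, (v : EuclideanSpace ℝ (Fin d ⊕ Fin T)) i •
            Sum.elim (fun i => Z₀ i ω) (fun t => z t ω) i
          map_add' v w := by simp [add_smul, Finset.sum_add_distrib]
          map_smul' c v := by simp [mul_smul, Finset.smul_sum] }
      exact abs_norm_map_sq_sub_le_of_net f hN1 hnet hω
        ⟨_, LinearMap.mem_range_self (Hypermodel.factorCoeff S₀ σ x) u⟩
  · intro 𝒳 h
    -- For the empty set `Real.log 0 = 0` does not force `M > 0`, but the claim is vacuous.
    rcases 𝒳.eq_empty_or_nonempty with rfl | hne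
    · have : {ω | Hypermodel.IsApproxFactorOn ε (Hypermodel.posteriorCov S₀ σ x)
          (Hypermodel.factor S₀ σ x (fun i => Z₀ i ω) (fun t => z t ω))
          ((∅ : Finset (EuclideanSpace ℝ (Fin d))) : Set (EuclideanSpace ℝ (Fin d)))} =
          Set.univ := by
        ext ω
        simp [Hypermodel.IsApproxFactorOn]
      rw [this, measure_univ]
      exact ENNReal.ofReal_le_one.2 (by linarith)
    have hc : (1 : ℝ) ≤ 𝒳.card := by exact_mod_cast hne.card_pos
    have h := hM _ h
    have hMpos : 0 < M := hM0 _ (Real.log_pos (h2δ.trans_le (by gcongr; linarith))) h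
    refine Hypermodel.ofReal_one_sub_le_measure
      ((hz.measure_exists_lt_abs_le hMpos 𝒳 (Hypermodel.factorCoeff S₀ σ x)
        hε hε1.le).trans (ENNReal.ofReal_le_ofReal ?_)) (fun ω hω => ?_) hδ.le
    -- Without a net the error is `ε` itself, so the bound at `ε / 2` is more than enough.
    · refine Hypermodel.mul_two_mul_exp_neg_le (by linarith) hδ (h.trans ?_)
      gcongr
      linarith
    · refine Hypermodel.isApproxFactorOn_of_abs_le σ x hS₀ fun u hu => ?_
      simp only [Set.mem_ofPred_eq, not_exists, not_and, not_not, helim] at hω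
      exact hω u (by simpa using hu)
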